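/- Let $\mathcal{C}$ be a bicategory. *Conventions.* For 1-cells $f:A\to B$, $g:C\to D$ write $f\perp g$ if the square of hom-categories with corners $\mathcal{C}[B,C]$, $\mathcal{C}[A,C]$, $\mathcal{C}[B,D]$, $\mathcal{C}[A,D]$ is a bipullback in $\mathbf{Cat}$, i.e. if $s\mapsto (sf, gs, g(sf)\cong(gs)f)$ is an equivalence from $\mathcal{C}[B,C]$ to the category of pseudosquares from $f$ to $g$. A *bifactorization system* on $\mathcal{C}$ is a pair $(\mathcal{L},\mathcal{R})$ of classes of 1-cells with $\mathcal{L}={}^{\perp}\mathcal{R}$ and $\mathcal{R}=\mathcal{L}^{\perp}$ such that every 1-cell $f$ admits an invertible 2-cell $r_fl_f\cong f$ with $l_f\in\mathcal{L}$, $r_f\in\mathcal{R}$, and every other such factorization $rl\cong f$ is related to it by an equivalence $i$ with invertible 2-cells $il\cong l_f$, $r\cong r_fi$ compatible with the two factorizations, the triple being unique up to a unique invertible 2-cell. An object $1$ is *biterminal* if each $\mathcal{C}[A,1]$ is equivalent to the terminal category. The *pseudoslice* $\mathcal{C}/C$ has as 0-cells the 1-cells $a:A\to C$, as 1-cells $a\to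 b$ the pairs $(u,\alpha)$ with $\alpha: bu\cong a$ invertible, and as 2-cells $(u,\alpha)\Rightarrow(u',\alpha')$ the 2-cells $\phi:u\Rightarrow u'$ with $\alpha'\cdot(b\phi)=\alpha$. The dual $(-)^{\mathrm{op}}$ of a bicategory reverses 1-cells only. Let $U:\mathcal{A}\to\mathcal{B}$ be a pseudofunctor. A 1-cell $n:B\to U(A)$ is *$U$-generic* if * for all $u:A_1\to A_2$, $v:A\to A_2$, $f:B\to U(A_1)$ and invertible $\alpha:U(u)f\cong U(v)n$ there are $w:A\to A_1$ and invertible 2-cells $\nu: f\cong U(w)n$, $\omega: uw\cong v$ such that $\alpha$ is the pasting of $\nu$ and $U(\omega)$, and the triple $(w,\nu,\omega)$ is unique up to a unique invertible 2-cell; * for $u,v$ fixed, any 2-cell $\phi:f_1\Rightarrow f_2$ with $\alpha_2\cdot(U(u)\phi)=\alpha_1$ and any triples $(w_i,\nu_i,\omega_i)$ as above for $\alpha_i$, there is a unique $\sigma:w_1\Rightarrow w_2$ with $\omega_2\cdot(u\sigma)=\omega_1$ and $\nu_2\cdot\phi=(U(\sigma)n)\cdot\nu_1$. $U$ is *bistable*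 if each $f:B\to U(A)$ admits an invertible 2-cell $U(u_f)n_f\cong f$ with $n_f: B\to U(A_f)$ $U$-generic and $u_f:A_f\to A$, and every other such factorization $U(u)n\cong f$ with $n:B\to U(A')$ $U$-generic is related to it by an equivalence $e:A'\to A_f$ with invertible 2-cells $n_f\cong U(e)n$ and $u_fe\cong u$ compatible with the two factorizations, the triple being unique up to a unique invertible 2-cell. **Theorem.** Let $(\mathcal{L},\mathcal{R})$ be a bifactorization system on a bicategory $\mathcal{C}$ with a biterminal object $1$. 1. Let $\mathcal{L}\text{-}\mathbf{Obj}$ be the sub-bicategory of $\mathcal{C}$ whose 0-cells are the objects $A$ whose terminal map $A\to 1$ is in $\mathcal{L}$, whose 1-cells are the $\mathcal{L}$-maps between them, and whose 2-cells are all 2-cells of $\mathcal{C}$ between those. Then the opposite of its inclusion, $\iota_{\mathcal{L}}^{\mathrm{op}}:\mathcal{L}\text{-}\mathbf{Obj}^{\mathrm{op}}\to\mathcal{C}^{\mathrm{op}}$, is bistable, and a 1-cell $B\to\iota_{\mathcal{L}}^{\mathrm{op}}(A)$ in $\mathcal{C}^{\mathrm{op}}$ is $\iota_{\mathcal{L}}^{\mathrm{op}}$-generic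 if and only if the corresponding 1-cell $A\to B$ of $\mathcal{C}$ is in $\mathcal{R}$. 2. For each object $C$ of $\mathcal{C}$, let $\mathcal{L}\text{-}\mathbf{Obj}_C$ be the sub-bicategory of $\mathcal{C}/C$ whose 0-cells are the $\mathcal{L}$-maps $a:A\to C$, whose 1-cells are the $(u,\alpha)$ with $u\in\mathcal{L}$, and whose 2-cells are all 2-cells of $\mathcal{C}/C$ between those. Then the opposite of its inclusion, $\iota_{\mathcal{L},C}^{\mathrm{op}}:\mathcal{L}\text{-}\mathbf{Obj}_C^{\mathrm{op}}\to(\mathcal{C}/C)^{\mathrm{op}}$, is bistable, and a 1-cell $b\to\iota_{\mathcal{L},C}^{\mathrm{op}}(a)$ in $(\mathcal{C}/C)^{\mathrm{op}}$ is $\iota_{\mathcal{L},C}^{\mathrm{op}}$-generic if and only if the corresponding 1-cell $(r,\rho):a\to b$ of $\mathcal{C}/C$ has $r\in\mathcal{R}$. -/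

import Mathlib

open CategoryTheory Bicategory Opposite Bicategory.Opposite

universe w v u w₁ v₁ u₁ w₂ v₂ u₂

namespace BistableInclusion

section Orthogonality

variable {C : Type u} [Bicategory.{w, v} C]

/-- The canonical comparison functor from `C[b, c]` to the category of pseudosquares from `f` to
`g`, i.e. to the pseudopullback of `C[a, g]` and `C[f, d]`.  Objects of the target are triples
`(u, v, α)` with `α : u ≫ g ≅ f ≫ v`, its morphisms are morphisms of pseudosquares; a diagonal `s`
is sent to `(f ≫ s, s ≫ g, associator)`. -/
def orthComparison {a b c d : C} (f : a ⟶ b) (g : c ⟶ d) :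
    (b ⟶ c) ⥤ Limits.CategoricalPullback (postcomp a g) (precomp d f) where
  obj s := ⟨f ≫ s, s ≫ g, α_ f s g⟩
  map σ := ⟨f ◁ σ, σ ▷ g, by
    change (f ◁ σ) ▷ g ≫ (α_ f _ g).hom = (α_ f _ g).hom ≫ f ◁ (σ ▷ g)
    simp⟩
  map_id s := by
    apply Limits.CategoricalPullback.hom_ext <;> simp
  map_comp σ τ := by
    apply Limits.CategoricalPullback.hom_ext <;> simp

/-- `f` is left bi-orthogonal to `g`: the square of hom-categories with corners `C[b, c]`,
`C[a, c]`, `C[b, d]`, `C[a, d]` is a bipullback of categories. -/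
def BiOrth {a b c d : C} (f : a ⟶ b) (g : c ⟶ d) : Prop :=
  (orthComparison f g).IsEquivalence

/-- Bi-orthogonality in terms of fillers. -/
theorem biOrth_iff {a b c d : C} (f : a ⟶ b) (g : c ⟶ d) :
    BiOrth f g ↔
      (∀ (s t : b ⟶ c) (φ : f ≫ s ⟶ f ≫ t) (ψ : s ≫ g ⟶ t ≫ g),
        φ ▷ g ≫ (α_ f t g).hom = (α_ f s g).hom ≫ f ◁ ψ →
        ∃! σ : s ⟶ t, f ◁ σ = φ ∧ σ ▷ g = ψ) ∧
      (∀ (u : a ⟶ c) (v : b ⟶ d) (α : u ≫ g ≅ f ≫ v),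
        ∃ (s : b ⟶ c) (l : f ≫ s ≅ u) (r : s ≫ g ≅ v),
          l.hom ▷ g ≫ α.hom = (α_ f s g).hom ≫ f ◁ r.hom) := by
  constructor
  · intro h
    have h : (orthComparison f g).IsEquivalence := h
    refine ⟨fun s t φ ψ e => ?_, fun u v α => ?_⟩
    · obtain ⟨σ, hσ⟩ := (orthComparison f g).map_surjective
        (X := s) (Y := t) (⟨φ, ψ, e⟩ : (orthComparison f g).obj s ⟶ (orthComparison f g).obj t)
      refine ⟨σ, ⟨congrArg Limits.CategoricalPullback.Hom.fst hσ,
        congrArg Limits.CategoricalPullback.Hom.snd hσ⟩, fun τ hτ => ?_⟩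
      apply (orthComparison f g).map_injective
      rw [hσ]
      exact Limits.CategoricalPullback.hom_ext hτ.1 hτ.2
    · let X : Limits.CategoricalPullback (postcomp a g) (precomp d f) := ⟨u, v, α⟩
      let e := (orthComparison f g).objObjPreimageIso X
      exact ⟨(orthComparison f g).objPreimage X,
        (Limits.CategoricalPullback.π₁ _ _).mapIso e,
        (Limits.CategoricalPullback.π₂ _ _).mapIso e, e.hom.w⟩
  · rintro ⟨h₁, h₂⟩
    refine @Functor.IsEquivalence.mk _ _ _ _ _ ⟨?_⟩ ⟨?_⟩ ⟨?_⟩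
    · intro s t σ τ e
      obtain ⟨_, _, hu⟩ := h₁ s t (f ◁ τ) (τ ▷ g) (by simp)
      rw [hu σ ⟨congrArg Limits.CategoricalPullback.Hom.fst e,
        congrArg Limits.CategoricalPullback.Hom.snd e⟩, hu τ ⟨rfl, rfl⟩]
    · intro s t φ
      obtain ⟨σ, hσ, _⟩ := h₁ s t φ.fst φ.snd φ.w
      exact ⟨σ, Limits.CategoricalPullback.hom_ext hσ.1 hσ.2⟩
    · intro X
      obtain ⟨s, l, r, e⟩ := h₂ X.fst X.snd X.iso
      exact ⟨s, ⟨Limits.CategoricalPullback.mkIso l r e⟩⟩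

theorem biOrth_id (a : C) {c d : C} (g : c ⟶ d) : BiOrth (𝟙 a) g := by
  rw [biOrth_iff]
  refine ⟨fun s t φ ψ e => ?_, fun u v α => ?_⟩
  · have e' : ψ = (λ_ _).inv ≫ (α_ _ _ _).inv ≫ φ ▷ g ≫ (α_ _ _ _).hom ≫ (λ_ _).hom := by
      rw [reassoc_of% e]; simp
    refine ⟨(λ_ s).inv ≫ φ ≫ (λ_ t).hom, ⟨by simp, ?_⟩, fun τ hτ => ?_⟩
    · rw [e']; simp
    · rw [← hτ.1]; simp
  · exact ⟨u, λ_ u, α ≪≫ λ_ v, by simp⟩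

theorem biOrth_comp {a b b' c d : C} {f : a ⟶ b} {f' : b ⟶ b'} {g : c ⟶ d}
    (h : BiOrth f g) (h' : BiOrth f' g) : BiOrth (f ≫ f') g := by
  rw [biOrth_iff] at h h' ⊢
  obtain ⟨h₁, h₂⟩ := h
  obtain ⟨h₁', h₂'⟩ := h'
  refine ⟨fun s t φ ψ e => ?_, fun u v α => ?_⟩
  · have e' : φ ▷ g = (α_ _ _ _).hom ≫ (f ≫ f') ◁ ψ ≫ (α_ _ _ _).inv := by
      rw [← reassoc_of% e]; simp
    obtain ⟨σ₁, ⟨hσ₁, hσ₁'⟩, hu₁⟩ := h₁ (f' ≫ s) (f' ≫ t)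
      ((α_ f f' s).inv ≫ φ ≫ (α_ f f' t).hom)
      ((α_ f' s g).hom ≫ f' ◁ ψ ≫ (α_ f' t g).inv) (by
        simp only [comp_whiskerRight, e']
        bicategory)
    obtain ⟨σ, ⟨hσ, hσ'⟩, hu⟩ := h₁' s t σ₁ ψ (by rw [hσ₁']; simp)
    refine ⟨σ, ⟨?_, hσ'⟩, ?_⟩
    · rw [comp_whiskerLeft, hσ, hσ₁]; simp
    · rintro τ ⟨hτ, hτ'⟩
      refine hu τ ⟨hu₁ _ ⟨?_, ?_⟩, hτ'⟩
      · rw [← hτ]; simp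
      · rw [← hτ']; simp
  · obtain ⟨s₁, l₁, r₁, e₁⟩ := h₂ u (f' ≫ v) (α ≪≫ α_ f f' v)
    obtain ⟨s, l, r, e⟩ := h₂' s₁ v r₁
    refine ⟨s, α_ f f' s ≪≫ whiskerLeftIso f l ≪≫ l₁, r, ?_⟩
    have e₁' : l₁.hom ▷ g ≫ α.hom =
        (α_ f s₁ g).hom ≫ f ◁ r₁.hom ≫ (α_ f f' v).inv := by
      rw [← reassoc_of% e₁]; simp
    have e' : r₁.hom = l.inv ▷ g ≫ (α_ f' s g).hom ≫ f' ◁ r.hom := by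
      rw [← e, ← comp_whiskerRight_assoc]; simp
    simp only [Iso.trans_hom, whiskerLeftIso_hom, comp_whiskerRight, Category.assoc, e₁', e']
    have : f ◁ l.hom ▷ g ≫ f ◁ l.inv ▷ g = 𝟙 _ := by
      rw [← whiskerLeft_comp, ← comp_whiskerRight]; simp
    simp only [whisker_assoc, Category.assoc, Iso.inv_hom_id_assoc, whiskerLeft_comp,
      reassoc_of% this]
    bicategory

end Orthogonality

section Bifactorization

variable {C : Type u} [Bicategory.{w, v} C]

/-- A comparison from a factorization `θ' : l' ≫ r' ≅ f` to a factorization `θ : l ≫ r ≅ f`: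
an equivalence `i` between the middle objects and invertible 2-cells `l' ≫ i ≅ l`,
`r' ≅ i ≫ r` which paste with `θ` to `θ'`. -/
structure FactComparison {a b m m' : C} {f : a ⟶ b} {l' : a ⟶ m'} {r' : m' ⟶ b} {l : a ⟶ m}
    {r : m ⟶ b} (θ' : l' ≫ r' ≅ f) (θ : l ≫ r ≅ f) where
  equiv : m' ≌ m
  left : l' ≫ equiv.hom ≅ l
  right : r' ≅ equiv.hom ≫ r
  fac : θ'.hom = l' ◁ right.hom ≫ (α_ _ _ _).inv ≫ left.hom ▷ r ≫ θ.hom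

/-- Bifactorization systems: a bi-orthogonality structure `(L, R)` (each class is the orthogonal of
the other) such that every 1-cell has an `(L, R)`-factorization up to an invertible 2-cell, to
which every other `(L, R)`-factorization compares through an equivalence that is unique up to a
unique invertible 2-cell. -/
structure IsBifactorizationSystem (L R : MorphismProperty C) : Prop where
  left_iff : ∀ {a b : C} (f : a ⟶ b), L f ↔ ∀ {c d : C} (g : c ⟶ d), R g → BiOrth f g
  right_iff : ∀ {c d : C} (g : c ⟶ d), R g ↔ ∀ {a b : C} (f : a ⟶ b), L f → BiOrth f g
  exists_fac : ∀ {a b : C} (f : a ⟶ b),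
    ∃ (m : C) (l : a ⟶ m) (r : m ⟶ b) (θ : l ≫ r ≅ f), L l ∧ R r ∧
      ∀ (m' : C) (l' : a ⟶ m') (r' : m' ⟶ b) (θ' : l' ≫ r' ≅ f), L l' → R r' →
        ∃ i : FactComparison θ' θ, ∀ j : FactComparison θ' θ,
          ∃! σ : i.equiv.hom ≅ j.equiv.hom,
            l' ◁ σ.hom ≫ j.left.hom = i.left.hom ∧ i.right.hom ≫ σ.hom ▷ r = j.right.hom

theorem IsBifactorizationSystem.left_id {L R : MorphismProperty C}
    (h : IsBifactorizationSystem L R) (a : C) : L (𝟙 a) :=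
  (h.left_iff _).2 fun g _ => biOrth_id a g

theorem IsBifactorizationSystem.left_comp {L R : MorphismProperty C}
    (h : IsBifactorizationSystem L R) {a b c : C} (f : a ⟶ b) (g : b ⟶ c) (hf : L f) (hg : L g) :
    L (f ≫ g) :=
  (h.left_iff _).2 fun k hk => biOrth_comp ((h.left_iff f).1 hf k hk) ((h.left_iff g).1 hg k hk)

/-- `t` is biterminal: every hom-category into `t` is equivalent to the terminal category. -/
def IsBiterminal (t : C) : Prop :=
  ∀ a : C, (Functor.star.{0} (a ⟶ t)).IsEquivalence

end Bifactorization

/-- The 0-cells of the pseudoslice of `C` over `c`. -/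
structure PseudoSlice {C : Type u} [Bicategory.{w, v} C] (c : C) where
  left : C
  hom : left ⟶ c

namespace PseudoSlice

variable {C : Type u} [Bicategory.{w, v} C] {c : C}

/-- The 1-cells of the pseudoslice: triangles filled with an invertible 2-cell. -/
structure Hom (X Y : PseudoSlice c) where
  left : X.left ⟶ Y.left
  iso : left ≫ Y.hom ≅ X.hom

instance : CategoryStruct (PseudoSlice c) where
  Hom X Y := Hom X Y
  id X := ⟨𝟙 X.left, λ_ X.hom⟩
  comp f g := ⟨f.left ≫ g.left, α_ _ _ _ ≪≫ whiskerLeftIso f.left g.iso ≪≫ f.iso⟩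

@[simp]
theorem id_left (X : PseudoSlice c) : Hom.left (𝟙 X) = 𝟙 X.left := rfl

@[simp]
theorem id_iso (X : PseudoSlice c) : Hom.iso (𝟙 X) = λ_ X.hom := rfl

@[simp]
theorem comp_left {X Y Z : PseudoSlice c} (f : X ⟶ Y) (g : Y ⟶ Z) :
    Hom.left (f ≫ g) = f.left ≫ g.left := rfl

@[simp]
theorem comp_iso {X Y Z : PseudoSlice c} (f : X ⟶ Y) (g : Y ⟶ Z) :
    Hom.iso (f ≫ g) = α_ _ _ _ ≪≫ whiskerLeftIso f.left g.iso ≪≫ f.iso := rfl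

/-- The 2-cells of the pseudoslice: 2-cells of `C` compatible with the triangles. -/
@[ext]
structure Hom₂ {X Y : PseudoSlice c} (f g : X ⟶ Y) where
  left : f.left ⟶ g.left
  w : left ▷ Y.hom ≫ g.iso.hom = f.iso.hom

instance homCategory (X Y : PseudoSlice c) : Category (X ⟶ Y) where
  Hom f g := Hom₂ f g
  id f := ⟨𝟙 f.left, by simp⟩
  comp φ ψ := ⟨φ.left ≫ ψ.left, by rw [comp_whiskerRight, Category.assoc, ψ.w, φ.w]⟩
  id_comp φ := Hom₂.ext (Category.id_comp _)
  comp_id φ := Hom₂.ext (Category.comp_id _)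
  assoc φ ψ χ := Hom₂.ext (Category.assoc _ _ _)

@[ext]
theorem hom₂_ext {X Y : PseudoSlice c} {f g : X ⟶ Y} {φ ψ : f ⟶ g} (h : φ.left = ψ.left) :
    φ = ψ :=
  Hom₂.ext h

@[simp]
theorem id₂_left {X Y : PseudoSlice c} (f : X ⟶ Y) : Hom₂.left (𝟙 f) = 𝟙 f.left := rfl

@[simp]
theorem comp₂_left {X Y : PseudoSlice c} {f g h : X ⟶ Y} (φ : f ⟶ g) (ψ : g ⟶ h) :
    Hom₂.left (φ ≫ ψ) = φ.left ≫ ψ.left := rfl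

/-- Invertible 2-cells of the pseudoslice from compatible invertible 2-cells of `C`. -/
def isoMk {X Y : PseudoSlice c} {f g : X ⟶ Y} (φ : f.left ≅ g.left)
    (h : φ.hom ▷ Y.hom ≫ g.iso.hom = f.iso.hom) : f ≅ g where
  hom := ⟨φ.hom, h⟩
  inv := ⟨φ.inv, by rw [← h]; simp⟩
  hom_inv_id := Hom₂.ext φ.hom_inv_id
  inv_hom_id := Hom₂.ext φ.inv_hom_id

@[simp]
theorem isoMk_hom_left {X Y : PseudoSlice c} {f g : X ⟶ Y} (φ : f.left ≅ g.left)
    (h : φ.hom ▷ Y.hom ≫ g.iso.hom = f.iso.hom) : Hom₂.left (isoMk φ h).hom = φ.hom := rfl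

@[simp]
theorem isoMk_inv_left {X Y : PseudoSlice c} {f g : X ⟶ Y} (φ : f.left ≅ g.left)
    (h : φ.hom ▷ Y.hom ≫ g.iso.hom = f.iso.hom) : Hom₂.left (isoMk φ h).inv = φ.inv := rfl

instance bicategory : Bicategory (PseudoSlice c) where
  homCategory := homCategory
  whiskerLeft f g h φ := ⟨f.left ◁ φ.left, by
    simp [← φ.w]⟩
  whiskerRight {X Y Z f g} φ h := ⟨φ.left ▷ h.left, by
    simp [← φ.w, whisker_exchange_assoc]⟩
  associator f g h := isoMk (α_ f.left g.left h.left) (by simp)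
  leftUnitor f := isoMk (λ_ f.left) (by simp)
  rightUnitor f := isoMk (ρ_ f.left) (by simp)
  whiskerLeft_id f g := Hom₂.ext (whiskerLeft_id _ _)
  whiskerLeft_comp f _ _ _ φ ψ := Hom₂.ext (whiskerLeft_comp _ _ _)
  id_whiskerLeft φ := Hom₂.ext (id_whiskerLeft _)
  comp_whiskerLeft f g _ _ φ := Hom₂.ext (comp_whiskerLeft _ _ _)
  id_whiskerRight f g := Hom₂.ext (id_whiskerRight _ _)
  comp_whiskerRight φ ψ g := Hom₂.ext (comp_whiskerRight _ _ _)
  whiskerRight_id φ := Hom₂.ext (whiskerRight_id _)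
  whiskerRight_comp φ g h := Hom₂.ext (whiskerRight_comp _ _ _)
  whisker_assoc f _ _ φ g := Hom₂.ext (whisker_assoc _ _ _)
  whisker_exchange φ ψ := Hom₂.ext (whisker_exchange _ _)
  pentagon f g h i := Hom₂.ext (pentagon _ _ _ _)
  triangle f g := Hom₂.ext (triangle _ _)

end PseudoSlice

/-- A class of 0-cells and a class of 1-cells of a bicategory, the latter closed under identities
and composition. -/
structure SubBicat (B : Type u) [Bicategory.{w, v} B] where
  obj : B → Prop
  map : MorphismProperty B
  id_mem : ∀ a : B, map (𝟙 a)
  comp_mem : ∀ {a b c : B} (f : a ⟶ b) (g : b ⟶ c), map f → map g → map (f ≫ g)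

namespace SubBicat

variable {B : Type u} [Bicategory.{w, v} B]

/-- The 0-cells of the sub-bicategory: those in the given class. -/
structure Obj (S : SubBicat B) where
  obj : B
  mem : S.obj obj

variable {S : SubBicat B}

/-- The 1-cells of the sub-bicategory: those in the given class. -/
structure Hom (X Y : S.Obj) where
  hom : X.obj ⟶ Y.obj
  mem : S.map hom

instance : CategoryStruct S.Obj where
  Hom X Y := Hom X Y
  id X := ⟨𝟙 X.obj, S.id_mem _⟩
  comp f g := ⟨f.hom ≫ g.hom, S.comp_mem _ _ f.mem g.mem⟩

@[simp]
theorem id_hom (X : S.Obj) : Hom.hom (𝟙 X) = 𝟙 X.obj := rfl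

@[simp]
theorem comp_hom {X Y Z : S.Obj} (f : X ⟶ Y) (g : Y ⟶ Z) :
    Hom.hom (f ≫ g) = f.hom ≫ g.hom := rfl

/-- The 2-cells of the sub-bicategory: all 2-cells between 1-cells in the given class. -/
@[ext]
structure Hom₂ {X Y : S.Obj} (f g : X ⟶ Y) where
  hom : f.hom ⟶ g.hom

instance homCategory (X Y : S.Obj) : Category (X ⟶ Y) where
  Hom f g := Hom₂ f g
  id f := ⟨𝟙 f.hom⟩
  comp φ ψ := ⟨φ.hom ≫ ψ.hom⟩
  id_comp _ := Hom₂.ext (Category.id_comp _)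
  comp_id _ := Hom₂.ext (Category.comp_id _)
  assoc _ _ _ := Hom₂.ext (Category.assoc _ _ _)

@[ext]
theorem hom₂_ext {X Y : S.Obj} {f g : X ⟶ Y} {φ ψ : f ⟶ g} (h : φ.hom = ψ.hom) : φ = ψ :=
  Hom₂.ext h

@[simp]
theorem id₂_hom {X Y : S.Obj} (f : X ⟶ Y) : Hom₂.hom (𝟙 f) = 𝟙 f.hom := rfl

@[simp]
theorem comp₂_hom {X Y : S.Obj} {f g h : X ⟶ Y} (φ : f ⟶ g) (ψ : g ⟶ h) :
    Hom₂.hom (φ ≫ ψ) = φ.hom ≫ ψ.hom := rfl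

/-- Invertible 2-cells of the sub-bicategory from invertible 2-cells of the ambient one. -/
def isoMk {X Y : S.Obj} {f g : X ⟶ Y} (φ : f.hom ≅ g.hom) : f ≅ g where
  hom := ⟨φ.hom⟩
  inv := ⟨φ.inv⟩
  hom_inv_id := Hom₂.ext φ.hom_inv_id
  inv_hom_id := Hom₂.ext φ.inv_hom_id

@[simp]
theorem isoMk_hom_hom {X Y : S.Obj} {f g : X ⟶ Y} (φ : f.hom ≅ g.hom) :
    Hom₂.hom (isoMk φ).hom = φ.hom := rfl

@[simp]
theorem isoMk_inv_hom {X Y : S.Obj} {f g : X ⟶ Y} (φ : f.hom ≅ g.hom) :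
    Hom₂.hom (isoMk φ).inv = φ.inv := rfl

instance bicategory : Bicategory S.Obj where
  homCategory := homCategory
  whiskerLeft f _ _ φ := ⟨f.hom ◁ φ.hom⟩
  whiskerRight φ h := ⟨φ.hom ▷ h.hom⟩
  associator f g h := isoMk (α_ f.hom g.hom h.hom)
  leftUnitor f := isoMk (λ_ f.hom)
  rightUnitor f := isoMk (ρ_ f.hom)
  whiskerLeft_id _ _ := Hom₂.ext (whiskerLeft_id _ _)
  whiskerLeft_comp _ _ _ _ _ _ := Hom₂.ext (whiskerLeft_comp _ _ _)
  id_whiskerLeft _ := Hom₂.ext (id_whiskerLeft _)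
  comp_whiskerLeft _ _ _ _ _ := Hom₂.ext (comp_whiskerLeft _ _ _)
  id_whiskerRight _ _ := Hom₂.ext (id_whiskerRight _ _)
  comp_whiskerRight _ _ _ := Hom₂.ext (comp_whiskerRight _ _ _)
  whiskerRight_id _ := Hom₂.ext (whiskerRight_id _)
  whiskerRight_comp _ _ _ := Hom₂.ext (whiskerRight_comp _ _ _)
  whisker_assoc _ _ _ _ _ := Hom₂.ext (whisker_assoc _ _ _)
  whisker_exchange _ _ := Hom₂.ext (whisker_exchange _ _)
  pentagon _ _ _ _ := Hom₂.ext (pentagon _ _ _ _)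
  triangle _ _ := Hom₂.ext (triangle _ _)

/-- The inclusion of the sub-bicategory in the ambient bicategory. -/
def inclusion (S : SubBicat B) : S.Obj ⥤ᵖ B where
  obj X := X.obj
  map f := f.hom
  map₂ φ := φ.hom
  map₂_id _ := rfl
  map₂_comp _ _ := rfl
  mapId _ := Iso.refl _
  mapComp _ _ := Iso.refl _
  map₂_whisker_left f _ _ φ := by
    change f.hom ◁ φ.hom = 𝟙 _ ≫ f.hom ◁ φ.hom ≫ 𝟙 _
    simp
  map₂_whisker_right φ h := by
    change φ.hom ▷ h.hom = 𝟙 _ ≫ φ.hom ▷ h.hom ≫ 𝟙 _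
    simp
  map₂_associator f g h := by
    change (α_ f.hom g.hom h.hom).hom = 𝟙 _ ≫ 𝟙 (f.hom ≫ g.hom) ▷ h.hom ≫ (α_ _ _ _).hom ≫
      f.hom ◁ 𝟙 (g.hom ≫ h.hom) ≫ 𝟙 _
    simp
  map₂_left_unitor {X Y} f := by
    change (λ_ f.hom).hom = 𝟙 _ ≫ 𝟙 (𝟙 X.obj) ▷ f.hom ≫ (λ_ f.hom).hom
    simp
  map₂_right_unitor {X Y} f := by
    change (ρ_ f.hom).hom = 𝟙 _ ≫ f.hom ◁ 𝟙 (𝟙 Y.obj) ≫ (ρ_ f.hom).hom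
    simp

end SubBicat

section Bistable

variable {A : Type u₁} [Bicategory.{w₁, v₁} A] {B : Type u₂} [Bicategory.{w₂, v₂} B]

/-- The pseudofunctor between the 1-cell duals induced by a pseudofunctor. -/
def opPseudofunctor (U : A ⥤ᵖ B) : Aᵒᵖ ⥤ᵖ Bᵒᵖ where
  obj X := op (U.obj X.unop)
  map f := (U.map f.unop).op
  map₂ φ := op2 (U.map₂ φ.unop2)
  map₂_id f := congrArg op2 (U.map₂_id f.unop)
  map₂_comp φ ψ := congrArg op2 (U.map₂_comp φ.unop2 ψ.unop2)
  mapId X := (U.mapId X.unop).op2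
  mapComp f g := (U.mapComp g.unop f.unop).op2
  map₂_whisker_left f _ _ φ := congrArg op2 (U.map₂_whisker_right φ.unop2 f.unop)
  map₂_whisker_right φ h := congrArg op2 (U.map₂_whisker_left h.unop φ.unop2)
  map₂_associator f g h := congrArg op2 (by
    change U.map₂ (α_ h.unop g.unop f.unop).inv =
      (U.mapComp h.unop (g.unop ≫ f.unop)).hom ≫
        U.map h.unop ◁ (U.mapComp g.unop f.unop).hom ≫
          (α_ (U.map h.unop) (U.map g.unop) (U.map f.unop)).inv ≫
            (U.mapComp h.unop g.unop).inv ▷ U.map f.unop ≫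
              (U.mapComp (h.unop ≫ g.unop) f.unop).inv
    rw [U.mapComp_assoc_right_hom_assoc]
    simp)
  map₂_left_unitor f := congrArg op2 (U.map₂_right_unitor f.unop)
  map₂_right_unitor f := congrArg op2 (U.map₂_left_unitor f.unop)

variable (U : A ⥤ᵖ B)

/-- A diagonal of the pseudosquare `α : f ≫ U u ≅ n ≫ U v`: a 1-cell `w` of `A` with invertible
2-cells `ν` in `B` and `ω` in `A` whose pasting, after applying `U` to `ω`, is `α`. -/
structure Diagonal {b : B} {a a₁ a₂ : A} {n : b ⟶ U.obj a} {f : b ⟶ U.obj a₁} {u : a₁ ⟶ a₂}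
    {v : a ⟶ a₂} (α : f ≫ U.map u ≅ n ≫ U.map v) where
  w : a ⟶ a₁
  ν : f ≅ n ≫ U.map w
  ω : w ≫ u ≅ v
  fac : α.hom = ν.hom ▷ U.map u ≫ (α_ _ _ _).hom ≫ n ◁ (U.mapComp w u).inv ≫ n ◁ U.map₂ ω.hom

variable {U}

/-- `σ` is a 2-cell between diagonals over the 2-cell `φ` between the upper sides. -/
def Diagonal.Compatible {b : B} {a a₁ a₂ : A} {n : b ⟶ U.obj a} {u : a₁ ⟶ a₂} {v : a ⟶ a₂}
    {f f' : b ⟶ U.obj a₁} {α : f ≫ U.map u ≅ n ≫ U.map v} {α' : f' ≫ U.map u ≅ n ≫ U.map v}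
    (φ : f ⟶ f') (D : Diagonal U α) (D' : Diagonal U α') (σ : D.w ⟶ D'.w) : Prop :=
  D.ω.hom = σ ▷ u ≫ D'.ω.hom ∧ φ ≫ D'.ν.hom = D.ν.hom ≫ n ◁ U.map₂ σ

variable (U)

/-- `U`-generic morphisms. -/
structure IsGeneric {b : B} {a : A} (n : b ⟶ U.obj a) : Prop where
  /-- Every pseudosquare has a diagonal, unique up to a unique invertible 2-cell. -/
  exists_diagonal : ∀ {a₁ a₂ : A} (u : a₁ ⟶ a₂) (v : a ⟶ a₂) (f : b ⟶ U.obj a₁)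
    (α : f ≫ U.map u ≅ n ≫ U.map v),
    ∃ D : Diagonal U α, ∀ D' : Diagonal U α,
      ∃! σ : D.w ≅ D'.w, Diagonal.Compatible (𝟙 f) D D' σ.hom
  /-- A morphism of pseudosquares with the same lower side induces a unique 2-cell between the
  diagonals. -/
  exists_unique_cell : ∀ {a₁ a₂ : A} (u : a₁ ⟶ a₂) (v : a ⟶ a₂) (f f' : b ⟶ U.obj a₁)
    (α : f ≫ U.map u ≅ n ≫ U.map v) (α' : f' ≫ U.map u ≅ n ≫ U.map v) (φ : f ⟶ f'),
    φ ▷ U.map u ≫ α'.hom = α.hom →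
    ∀ (D : Diagonal U α) (D' : Diagonal U α'),
      ∃! σ : D.w ⟶ D'.w, Diagonal.Compatible φ D D' σ

/-- `U` is bistable: every `f : b ⟶ U a` factors up to an invertible 2-cell as a generic morphism
`n` followed by some `U u`, and any other such factorization `(n', u')` compares to it through an
equivalence `e` with `n' ≫ U e ≅ n` and `e ≫ u ≅ u'`, unique up to a unique invertible 2-cell. -/
def IsBistable : Prop :=
  ∀ {b : B} {a : A} (f : b ⟶ U.obj a),
    ∃ (m : A) (n : b ⟶ U.obj m) (u : m ⟶ a) (θ : n ≫ U.map u ≅ f), IsGeneric U n ∧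
      ∀ (m' : A) (n' : b ⟶ U.obj m') (u' : m' ⟶ a) (θ' : n' ≫ U.map u' ≅ f), IsGeneric U n' →
        ∃ D : Diagonal U (θ ≪≫ θ'.symm), (∃ e : m' ≌ m, e.hom = D.w) ∧
          ∀ D' : Diagonal U (θ ≪≫ θ'.symm),
            ∃! σ : D.w ≅ D'.w, Diagonal.Compatible (𝟙 n) D D' σ.hom

end Bistable

section LeftObjects

variable {C : Type u} [Bicategory.{w, v} C] {L R : MorphismProperty C}

/-- Left objects (those with a terminal map in `L`), and `L`-maps between them. -/
def leftObj (h : IsBifactorizationSystem L R) (t : C) : SubBicat C where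
  obj a := ∃ p : a ⟶ t, L p
  map := L
  id_mem := h.left_id
  comp_mem := h.left_comp

/-- Left objects over `c`: the sub-bicategory of the pseudoslice over `c` on the 0-cells in `L`
and the triangles whose upper side is in `L`. -/
def leftObjOver (h : IsBifactorizationSystem L R) (c : C) : SubBicat (PseudoSlice c) where
  obj X := L X.hom
  map _ _ f := L f.left
  id_mem X := h.left_id X.left
  comp_mem f g := h.left_comp f.left g.left

end LeftObjects

end BistableInclusion

open BistableInclusion

/-!
Diagonals for the opposite of the inclusion of the left objects are fillers of pseudosquares with
two sides in `L`. Since `L` is right cancellable, a filler against an `R`-map is again in `L`, and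
the middle of an `(L, R)`-factorization of a 1-cell out of a left object is again a left object;
hence `R`-maps are generic and the factorizations exist. Conversely, a generic 1-cell and the
`R`-part of its factorization are two generic parts of the same 1-cell, so they differ by an
equivalence, and `R` is stable under precomposition with equivalences. Closure properties of right
orthogonals reduce to those of left orthogonals because `f ⊥ g` if and only if `gᵒᵖ ⊥ fᵒᵖ`.
-/

namespace BistableInclusion

section Orthogonality

variable {C : Type u} [Bicategory.{w, v} C] {a b c d : C}

section

variable {f : a ⟶ b} {g : c ⟶ d}

theorem BiOrth.existsUnique_cell (h : BiOrth f g) {s t : b ⟶ c} (φ : f ≫ s ⟶ f ≫ t)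
    (ψ : s ≫ g ⟶ t ≫ g) (w : φ ▷ g ≫ (α_ f t g).hom = (α_ f s g).hom ≫ f ◁ ψ) :
    ∃! σ : s ⟶ t, f ◁ σ = φ ∧ σ ▷ g = ψ :=
  ((biOrth_iff f g).1 h).1 s t φ ψ w

theorem BiOrth.exists_filler (h : BiOrth f g) {u : a ⟶ c} {v : b ⟶ d} (α : u ≫ g ≅ f ≫ v) :
    ∃ (s : b ⟶ c) (l : f ≫ s ≅ u) (r : s ≫ g ≅ v),
      l.hom ▷ g ≫ α.hom = (α_ f s g).hom ≫ f ◁ r.hom :=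
  ((biOrth_iff f g).1 h).2 u v α

theorem BiOrth.cell_ext (h : BiOrth f g) {s t : b ⟶ c} {σ τ : s ⟶ t} (hf : f ◁ σ = f ◁ τ)
    (hg : σ ▷ g = τ ▷ g) : σ = τ :=
  (h.existsUnique_cell (f ◁ τ) (τ ▷ g) (by simp)).unique ⟨hf, hg⟩ ⟨rfl, rfl⟩

theorem BiOrth.exists_iso (h : BiOrth f g) {s t : b ⟶ c} (φ : f ≫ s ≅ f ≫ t) (ψ : s ≫ g ≅ t ≫ g)
    (w : φ.hom ▷ g ≫ (α_ f t g).hom = (α_ f s g).hom ≫ f ◁ ψ.hom) :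
    ∃ σ : s ≅ t, f ◁ σ.hom = φ.hom ∧ σ.hom ▷ g = ψ.hom := by
  have : (orthComparison f g).IsEquivalence := h
  let θ : (orthComparison f g).obj s ≅ (orthComparison f g).obj t :=
    Limits.CategoricalPullback.mkIso φ ψ w
  have hθ : (orthComparison f g).map ((orthComparison f g).preimageIso θ).hom = θ.hom := by simp
  exact ⟨(orthComparison f g).preimageIso θ, congrArg Limits.CategoricalPullback.Hom.fst hθ,
    congrArg Limits.CategoricalPullback.Hom.snd hθ⟩

theorem BiOrth.of_iso_left {f' : a ⟶ b} (h : BiOrth f g) (i : f ≅ f') : BiOrth f' g := by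
  refine (biOrth_iff f' g).2 ⟨fun s t φ ψ w => ?_, fun u v α => ?_⟩
  · have hψ : f ◁ ψ = i.hom ▷ (s ≫ g) ≫ f' ◁ ψ ≫ i.inv ▷ (t ≫ g) := by
      rw [← whisker_exchange_assoc]
      simp
    obtain ⟨σ, ⟨hφ, hσ⟩, unique⟩ :=
      h.existsUnique_cell (i.hom ▷ s ≫ φ ≫ i.inv ▷ t) ψ (by simp [hψ, ← reassoc_of% w])
    refine ⟨σ, ⟨?_, hσ⟩, fun τ hτ => unique τ ⟨?_, hτ.2⟩⟩
    · rw [← cancel_epi (i.hom ▷ s), ← whisker_exchange, hφ]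
      simp
    · rw [← hτ.1, ← whisker_exchange_assoc]
      simp
  · obtain ⟨s, l, r, w⟩ := h.exists_filler (α ≪≫ whiskerRightIso i.symm v)
    refine ⟨s, whiskerRightIso i.symm s ≪≫ l, r, ?_⟩
    have w' : l.hom ▷ g ≫ α.hom = (α_ f s g).hom ≫ f ◁ r.hom ≫ i.hom ▷ v := by
      simp [← reassoc_of% w]
    simp [w', whisker_exchange]

theorem BiOrth.of_comp_left {b' : C} {f' : b ⟶ b'} (h : BiOrth f g) (h' : BiOrth (f ≫ f') g) :
    BiOrth f' g := by
  refine (biOrth_iff f' g).2 ⟨fun s t φ ψ w => ?_, fun u v α => ?_⟩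
  · have hφ : φ ▷ g = (α_ _ _ _).hom ≫ f' ◁ ψ ≫ (α_ _ _ _).inv := by simp [← reassoc_of% w]
    obtain ⟨σ, ⟨hσ, hψ⟩, unique⟩ := h'.existsUnique_cell
      ((α_ f f' s).hom ≫ f ◁ φ ≫ (α_ f f' t).inv) ψ (by simp [hφ])
    refine ⟨σ, ⟨h.cell_ext ?_ ?_, hψ⟩, fun τ hτ => unique τ ⟨?_, hτ.2⟩⟩
    · simpa using hσ
    · simp [hφ, hψ]
    · simp [← hτ.1]
  · obtain ⟨s, l, r, w⟩ :=
      h'.exists_filler (α_ f u g ≪≫ whiskerLeftIso f α ≪≫ (α_ f f' v).symm)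
    have w' : l.hom ▷ g ≫ (α_ f u g).hom =
        (α_ (f ≫ f') s g).hom ≫ (f ≫ f') ◁ r.hom ≫ (α_ f f' v).hom ≫ f ◁ α.inv := by
      rw [← reassoc_of% w]
      simp
    obtain ⟨σ, -, hσ⟩ := h.exists_iso ((α_ f f' s).symm ≪≫ l)
      (α_ f' s g ≪≫ whiskerLeftIso f' r ≪≫ α.symm) (by simp [w'])
    exact ⟨s, σ, r, by simp [hσ]⟩

theorem comp_hom_eq_iff_comp_inv_eq {𝒜 : Type*} [Category* 𝒜] {x x' y y' : 𝒜} {i : x ≅ x'}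
    {j : y ≅ y'} {p : x ⟶ y} {q : x' ⟶ y'} :
    p ≫ j.hom = i.hom ≫ q ↔ q ≫ j.inv = i.inv ≫ p := by
  rw [Iso.comp_inv_eq, Category.assoc, Iso.eq_inv_comp, eq_comm]

theorem biOrth_op_iff : BiOrth g.op f.op ↔ BiOrth f g := by
  constructor <;> intro h
  · refine (biOrth_iff f g).2 ⟨fun s t φ ψ w => ?_, fun u v α => ?_⟩
    · obtain ⟨σ, ⟨hψ, hφ⟩, unique⟩ := h.existsUnique_cell (s := s.op) (t := t.op) (op2 ψ) (op2 φ)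
        (congrArg op2 (comp_hom_eq_iff_comp_inv_eq.1 w))
      exact ⟨σ.unop2, ⟨congrArg Hom2.unop2 hφ, congrArg Hom2.unop2 hψ⟩, fun τ hτ =>
        congrArg Hom2.unop2 (unique (op2 τ) ⟨congrArg op2 hτ.2, congrArg op2 hτ.1⟩)⟩
    · obtain ⟨s, r, l, w⟩ := h.exists_filler (u := v.op) (v := u.op) α.symm.op2
      exact ⟨s.unop, l.unop2, r.unop2, comp_hom_eq_iff_comp_inv_eq.2 (congrArg Hom2.unop2 w)⟩
  · refine (biOrth_iff g.op f.op).2 ⟨fun s t φ ψ w => ?_, fun u v α => ?_⟩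
    · obtain ⟨σ, ⟨hψ, hφ⟩, unique⟩ := h.existsUnique_cell ψ.unop2 φ.unop2
        (comp_hom_eq_iff_comp_inv_eq.2 (congrArg Hom2.unop2 w))
      exact ⟨op2 σ, ⟨congrArg op2 hφ, congrArg op2 hψ⟩, fun τ hτ =>
        congrArg op2 (unique τ.unop2 ⟨congrArg Hom2.unop2 hτ.2, congrArg Hom2.unop2 hτ.1⟩)⟩
    · obtain ⟨s, l, r, w⟩ := h.exists_filler (u := v.unop) (v := u.unop) α.symm.unop2
      exact ⟨s.op, r.op2, l.op2, congrArg op2 (comp_hom_eq_iff_comp_inv_eq.1 w)⟩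

theorem BiOrth.of_iso_right {g' : c ⟶ d} (h : BiOrth f g) (i : g ≅ g') : BiOrth f g' :=
  biOrth_op_iff.1 ((biOrth_op_iff.2 h).of_iso_left i.op2)

theorem BiOrth.comp_right {d' : C} {g' : d ⟶ d'} (h : BiOrth f g) (h' : BiOrth f g') :
    BiOrth f (g ≫ g') :=
  biOrth_op_iff.1 (biOrth_comp (biOrth_op_iff.2 h') (biOrth_op_iff.2 h))

end

open Limits.CategoricalPullback in
theorem isEquivalence_π₂ {𝒜 ℬ 𝒞 : Type*} [Category* 𝒜] [Category* ℬ] [Category* 𝒞] (F : 𝒜 ⥤ ℬ)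
    (G : 𝒞 ⥤ ℬ) [F.IsEquivalence] : (π₂ F G).IsEquivalence where
  faithful := ⟨fun {x y φ ψ} h => hom_ext (F.map_injective (by
    rw [← cancel_mono y.iso.hom, φ.w, ψ.w]
    exact congrArg (x.iso.hom ≫ G.map ·) h)) h⟩
  full := ⟨fun {x y} (ψ : x.snd ⟶ y.snd) =>
    ⟨⟨F.preimage (x.iso.hom ≫ G.map ψ ≫ y.iso.inv), ψ, by simp⟩, rfl⟩⟩
  essSurj := ⟨fun z => ⟨⟨F.objPreimage (G.obj z), z, F.objObjPreimageIso (G.obj z)⟩, ⟨Iso.refl z⟩⟩⟩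

theorem isEquivalence_postcomp (a : C) (e : c ≌ d) : (postcomp a e.hom).IsEquivalence :=
  (CategoryTheory.Equivalence.mk (postcomp a e.hom) (postcomp a e.inv)
    ((rightUnitorNatIso a c).symm ≪≫ (postcomposing a c c).mapIso e.unit ≪≫
      (associatorNatIsoLeft a e.hom e.inv).symm)
    (associatorNatIsoLeft a e.inv e.hom ≪≫ (postcomposing a d d).mapIso e.counit ≪≫
      rightUnitorNatIso a d)).isEquivalence_functor

theorem biOrth_equivalence_hom (f : a ⟶ b) (e : c ≌ d) : BiOrth f e.hom := by
  have := isEquivalence_postcomp a e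
  have := isEquivalence_π₂ (postcomp a e.hom) (precomp d f)
  have : (orthComparison f e.hom ⋙ Limits.CategoricalPullback.π₂ _ _).IsEquivalence :=
    isEquivalence_postcomp b e
  exact Functor.isEquivalence_of_comp_right (orthComparison f e.hom)
    (Limits.CategoricalPullback.π₂ (postcomp a e.hom) (precomp d f))

end Orthogonality

section Bifactorization

variable {C : Type u} [Bicategory.{w, v} C] {L R : MorphismProperty C} {a b c d : C}

theorem IsBifactorizationSystem.biOrth (h : IsBifactorizationSystem L R) {f : a ⟶ b} {g : c ⟶ d}
    (hf : L f) (hg : R g) : BiOrth f g :=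
  (h.left_iff f).1 hf g hg

theorem IsBifactorizationSystem.left_of_comp (h : IsBifactorizationSystem L R) {f : a ⟶ b}
    {g : b ⟶ c} {k : a ⟶ c} (i : f ≫ g ≅ k) (hf : L f) (hk : L k) : L g :=
  (h.left_iff g).2 fun _ hr => (h.biOrth hf hr).of_comp_left ((h.biOrth hk hr).of_iso_left i.symm)

theorem IsBifactorizationSystem.right_of_equivalence_comp (h : IsBifactorizationSystem L R)
    (e : a ≌ b) {r : b ⟶ c} {k : a ⟶ c} (i : e.hom ≫ r ≅ k) (hr : R r) : R k :=
  (h.right_iff k).2 fun f hf =>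
    ((biOrth_equivalence_hom f e).comp_right (h.biOrth hf hr)).of_iso_right i

theorem IsBiterminal.nonempty_hom {t : C} (ht : IsBiterminal t) (a : C) : Nonempty (a ⟶ t) :=
  have := ht a
  ⟨(Functor.star.{0} (a ⟶ t)).objPreimage ⟨⟨⟩⟩⟩

theorem IsBiterminal.nonempty_iso {t : C} (ht : IsBiterminal t) (p q : a ⟶ t) :
    Nonempty (p ≅ q) :=
  have := ht a
  ⟨(Functor.star.{0} (a ⟶ t)).preimageIso (Iso.refl _)⟩

end Bifactorization

section Equivalences

variable {A : Type u₁} [Bicategory.{w₁, v₁} A] {B : Type u₂} [Bicategory.{w₂, v₂} B]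

/-- The image under a pseudofunctor of an equivalence of a bicategory. -/
def mapEquivalence (U : A ⥤ᵖ B) {a a' : A} (e : a ≌ a') : U.obj a ≌ U.obj a' :=
  Equivalence.mkOfAdjointifyCounit (f := U.map e.hom) (g := U.map e.inv)
    ((U.mapId a).symm ≪≫ U.map₂Iso e.unit ≪≫ U.mapComp e.hom e.inv)
    ((U.mapComp e.inv e.hom).symm ≪≫ U.map₂Iso e.counit ≪≫ U.mapId a')

/-- The equivalence of `B` corresponding to one of the 1-cell dual of `B`. -/
def unopEquivalence {x y : Bᵒᵖ} (e : x ≌ y) : y.unop ≌ x.unop :=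
  Equivalence.mkOfAdjointifyCounit (f := e.hom.unop) (g := e.inv.unop) e.counit.symm.unop2
    e.unit.symm.unop2

end Equivalences

section Diagonals

variable {A : Type u₁} [Bicategory.{w₁, v₁} A] {B : Type u₂} [Bicategory.{w₂, v₂} B]
  {U : A ⥤ᵖ B} {b : B} {a a₁ a₂ : A} {n : b ⟶ U.obj a} {u : a₁ ⟶ a₂} {v : a ⟶ a₂}

namespace Diagonal

/-- The identity diagonal of an identity pseudosquare. -/
def refl (n : b ⟶ U.obj a) (v : a ⟶ a₂) : Diagonal U (Iso.refl (n ≫ U.map v)) where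
  w := 𝟙 a
  ν := (ρ_ n).symm ≪≫ whiskerLeftIso n (U.mapId a).symm
  ω := λ_ v
  fac := by simp [Pseudofunctor.map₂_left_unitor]

/-- The composite of diagonals of two pseudosquares pasted along a common side. -/
def comp {a₃ : A} {f : b ⟶ U.obj a₁} {g : b ⟶ U.obj a₃} {z : a₃ ⟶ a₂}
    {β : g ≫ U.map z ≅ f ≫ U.map u} {α : f ≫ U.map u ≅ n ≫ U.map v} (E : Diagonal U β)
    (D : Diagonal U α) : Diagonal U (β ≪≫ α) where
  w := D.w ≫ E.w
  ν := E.ν ≪≫ whiskerRightIso D.ν (U.map E.w) ≪≫ α_ _ _ _ ≪≫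
    whiskerLeftIso n (U.mapComp D.w E.w).symm
  ω := α_ _ _ _ ≪≫ whiskerLeftIso D.w E.ω ≪≫ D.ω
  fac := by
    have exchange : f ◁ (U.mapComp E.w z).inv ≫ f ◁ U.map₂ E.ω.hom ≫ D.ν.hom ▷ U.map u =
        D.ν.hom ▷ (U.map E.w ≫ U.map z) ≫ (n ≫ U.map D.w) ◁ (U.mapComp E.w z).inv ≫
          (n ≫ U.map D.w) ◁ U.map₂ E.ω.hom := by
      simp only [whisker_exchange, whisker_exchange_assoc]
    simp only [Iso.trans_hom, E.fac, D.fac, Category.assoc, reassoc_of% exchange]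
    simp [Pseudofunctor.map₂_associator, Pseudofunctor.map₂_whisker_left]

theorem Compatible.refl {f : b ⟶ U.obj a₁} {α : f ≫ U.map u ≅ n ≫ U.map v} (D : Diagonal U α) :
    Compatible (𝟙 f) D D (𝟙 D.w) :=
  ⟨by simp, by simp⟩

theorem Compatible.trans {f f' f'' : b ⟶ U.obj a₁} {α : f ≫ U.map u ≅ n ≫ U.map v}
    {α' : f' ≫ U.map u ≅ n ≫ U.map v} {α'' : f'' ≫ U.map u ≅ n ≫ U.map v} {D : Diagonal U α}
    {D' : Diagonal U α'} {D'' : Diagonal U α''} {φ : f ⟶ f'} {φ' : f' ⟶ f''} {σ : D.w ⟶ D'.w}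
    {σ' : D'.w ⟶ D''.w} (h : Compatible φ D D' σ) (h' : Compatible φ' D' D'' σ') :
    Compatible (φ ≫ φ') D D'' (σ ≫ σ') :=
  ⟨by simp [h.1, h'.1], by simp [h'.2, reassoc_of% h.2]⟩

end Diagonal

theorem isGeneric_of_existsUnique_cell
    (nonempty_diagonal : ∀ {a₁ a₂ : A} (u : a₁ ⟶ a₂) (v : a ⟶ a₂) (f : b ⟶ U.obj a₁)
      (α : f ≫ U.map u ≅ n ≫ U.map v), Nonempty (Diagonal U α))
    (existsUnique_cell : ∀ {a₁ a₂ : A} (u : a₁ ⟶ a₂) (v : a ⟶ a₂) (f f' : b ⟶ U.obj a₁)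
      (α : f ≫ U.map u ≅ n ≫ U.map v) (α' : f' ≫ U.map u ≅ n ≫ U.map v) (φ : f ⟶ f'),
      φ ▷ U.map u ≫ α'.hom = α.hom → ∀ (D : Diagonal U α) (D' : Diagonal U α'),
        ∃! σ : D.w ⟶ D'.w, Diagonal.Compatible φ D D' σ) :
    IsGeneric U n where
  exists_diagonal u v f α := by
    have cell (D D' : Diagonal U α) : ∃! σ : D.w ⟶ D'.w, Diagonal.Compatible (𝟙 f) D D' σ :=
      existsUnique_cell u v f f α α (𝟙 f) (by simp) D D'
    obtain ⟨D⟩ := nonempty_diagonal u v f α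
    refine ⟨D, fun D' => ?_⟩
    obtain ⟨σ, hσ, unique⟩ := cell D D'
    obtain ⟨τ, hτ, -⟩ := cell D' D
    have hστ : σ ≫ τ = 𝟙 D.w := (cell D D).unique (by simpa using hσ.trans hτ) (.refl D)
    have hτσ : τ ≫ σ = 𝟙 D'.w := (cell D' D').unique (by simpa using hτ.trans hσ) (.refl D')
    exact ⟨⟨σ, τ, hστ, hτσ⟩, hσ, fun ρ hρ => Iso.ext (unique ρ.hom hρ)⟩
  exists_unique_cell := existsUnique_cell

variable {f : b ⟶ U.obj a₁} {α : f ≫ U.map u ≅ n ≫ U.map v}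

theorem IsGeneric.nonempty_iso (hn : IsGeneric U n) {α' : f ≫ U.map u ≅ n ≫ U.map v}
    (hα : α = α') (D : Diagonal U α) (D' : Diagonal U α') : Nonempty (D.w ≅ D'.w) := by
  subst hα
  obtain ⟨D₀, hD₀⟩ := hn.exists_diagonal u v f α
  obtain ⟨σ, -⟩ := hD₀ D
  obtain ⟨σ', -⟩ := hD₀ D'
  exact ⟨σ.symm ≪≫ σ'⟩

theorem IsGeneric.exists_equivalence (hn : IsGeneric U n) (hf : IsGeneric U f)
    (D : Diagonal U α) : ∃ e : a ≌ a₁, e.hom = D.w := by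
  obtain ⟨E, -⟩ := hf.exists_diagonal v u n α.symm
  obtain ⟨η⟩ := hn.nonempty_iso α.symm_self_id.symm (.refl n v) (E.comp D)
  obtain ⟨κ⟩ := hf.nonempty_iso α.self_symm_id (D.comp E) (.refl f u)
  exact ⟨Equivalence.mkOfAdjointifyCounit (f := D.w) (g := E.w) η κ, rfl⟩

theorem isBistable_of_exists_fac
    (h : ∀ {b : B} {a : A} (f : b ⟶ U.obj a), ∃ (m : A) (n : b ⟶ U.obj m) (u : m ⟶ a),
      IsGeneric U n ∧ Nonempty (n ≫ U.map u ≅ f)) :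
    IsBistable U := by
  intro b a f
  obtain ⟨m, n, u, hn, ⟨θ⟩⟩ := h f
  refine ⟨m, n, u, θ, hn, fun m' n' u' θ' hn' => ?_⟩
  obtain ⟨D, hD⟩ := hn'.exists_diagonal u u' n (θ ≪≫ θ'.symm)
  exact ⟨D, hn'.exists_equivalence hn D, hD⟩

end Diagonals

namespace SubBicat

variable {B : Type u} [Bicategory.{w, v} B] {S : SubBicat B} {R : MorphismProperty B}
  {A A₁ A₂ : S.Obj} {b : B} {r : A.obj ⟶ b} {f f' : A₁.obj ⟶ b} {u : A₂ ⟶ A₁} {v : A₂ ⟶ A}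

/-- Diagonals, for the opposite of the inclusion of `S`, of a pseudosquare given as an invertible
2-cell of the ambient bicategory. -/
abbrev OpDiagonal (β : u.hom ≫ f ≅ v.hom ≫ r) : Type _ :=
  Diagonal (opPseudofunctor S.inclusion) (b := op b) (a := op A) (a₁ := op A₁) (a₂ := op A₂)
    (n := r.op) (f := f.op) (u := u.op) (v := v.op) β.op2

namespace OpDiagonal

variable {β : u.hom ≫ f ≅ v.hom ≫ r} {β' : u.hom ≫ f' ≅ v.hom ≫ r}

/-- The 1-cell of the ambient bicategory underlying a diagonal. -/
abbrev lift (D : OpDiagonal β) : A₁.obj ⟶ A.obj := D.w.unop.hom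

/-- The triangle between a diagonal and the right side of its pseudosquare. -/
def lower (D : OpDiagonal β) : f ≅ D.lift ≫ r := D.ν.unop2

/-- The triangle between a diagonal and the left side of its pseudosquare. -/
def upper (D : OpDiagonal β) : u.hom ≫ D.lift ≅ v.hom := S.inclusion.map₂Iso D.ω.unop2

theorem square_hom_eq (D : OpDiagonal β) :
    β.hom = u.hom ◁ D.lower.hom ≫ (α_ u.hom D.lift r).inv ≫ D.upper.hom ▷ r := by
  have h : β.hom = u.hom ◁ D.lower.hom ≫ (α_ u.hom D.lift r).inv ≫ 𝟙 (u.hom ≫ D.lift) ▷ r ≫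
      D.upper.hom ▷ r := congrArg Hom2.unop2 D.fac
  simpa using h

/-- The diagonal with prescribed triangles. -/
def ofTriangles (s : A₁ ⟶ A) (lower : f ≅ s.hom ≫ r) (upper : u.hom ≫ s.hom ≅ v.hom)
    (fac : β.hom = u.hom ◁ lower.hom ≫ (α_ u.hom s.hom r).inv ≫ upper.hom ▷ r) :
    OpDiagonal β where
  w := s.op
  ν := lower.op2
  ω := (isoMk (f := u ≫ s) (g := v) upper).op2
  fac := by
    have h : β.hom = u.hom ◁ lower.hom ≫ (α_ u.hom s.hom r).inv ≫ 𝟙 (u.hom ≫ s.hom) ▷ r ≫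
        upper.hom ▷ r := by simpa using fac
    exact congrArg op2 h

theorem compatible_op2_iff {D : OpDiagonal β} {D' : OpDiagonal β'} {φ : f ⟶ f'}
    {σ : D.w.unop ⟶ D'.w.unop} : Diagonal.Compatible (op2 φ) D D' (op2 σ) ↔
      u.hom ◁ σ.hom = D.upper.hom ≫ D'.upper.inv ∧ σ.hom ▷ r = D.lower.inv ≫ φ ≫ D'.lower.hom := by
  rw [Iso.eq_comp_inv, Iso.eq_inv_comp]
  exact ⟨fun h => ⟨congrArg (fun x => Hom₂.hom (Hom2.unop2 x)) h.1.symm,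
      congrArg Hom2.unop2 h.2.symm⟩,
    fun h => ⟨congrArg op2 (hom₂_ext h.1.symm), congrArg op2 h.2.symm⟩⟩

theorem nonempty_of_biOrth (h : BiOrth u.hom r) (β : u.hom ≫ f ≅ v.hom ≫ r)
    (map_lift : ∀ s : A₁.obj ⟶ A.obj, (u.hom ≫ s ≅ v.hom) → S.map s) :
    Nonempty (OpDiagonal β) := by
  obtain ⟨s, l, k, w⟩ := h.exists_filler β.symm
  have w' : l.hom ▷ r = (α_ u.hom s r).hom ≫ u.hom ◁ k.hom ≫ β.hom := by
    rw [← reassoc_of% w]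
    simp
  exact ⟨ofTriangles ⟨s, map_lift s l⟩ k.symm l (by simp [w'])⟩

theorem existsUnique_compatible (h : BiOrth u.hom r) (φ : f ⟶ f')
    (hφ : u.hom ◁ φ ≫ β'.hom = β.hom) (D : OpDiagonal β) (D' : OpDiagonal β') :
    ∃! σ : D.w ⟶ D'.w, Diagonal.Compatible (op2 φ) D D' σ := by
  rw [D.square_hom_eq, D'.square_hom_eq] at hφ
  obtain ⟨σ, hσ, unique⟩ := h.existsUnique_cell (D.upper.hom ≫ D'.upper.inv)
    (D.lower.inv ≫ φ ≫ D'.lower.hom) (by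
      rw [← cancel_epi (α_ u.hom D.lift r).inv, ← cancel_epi (u.hom ◁ D.lower.hom),
        comp_whiskerRight_assoc, ← reassoc_of% hφ]
      simp)
  exact ⟨op2 ⟨σ⟩, compatible_op2_iff.2 hσ, fun τ hτ =>
    congrArg op2 (hom₂_ext (unique _ (compatible_op2_iff.1 hτ)))⟩

end OpDiagonal

/-- What remains of a bifactorization system when its left class is restricted to `S`: the class
`S.map` is left orthogonal to `R` and right cancellable, `R` is stable under precomposition with
equivalences, and the 1-cells out of a 0-cell of `S` factor through a 0-cell of `S`. -/
structure IsLeftPart (S : SubBicat B) (R : MorphismProperty B) : Prop where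
  biOrth : ∀ {a b c d : B} {f : a ⟶ b} {g : c ⟶ d}, S.map f → R g → BiOrth f g
  map_of_comp : ∀ {a b c : B} {f : a ⟶ b} {g : b ⟶ c} {k : a ⟶ c}, (f ≫ g ≅ k) →
    S.map f → S.map k → S.map g
  right_of_equivalence_comp : ∀ {a b c : B} (e : a ≌ b) {r : b ⟶ c} {k : a ⟶ c},
    (e.hom ≫ r ≅ k) → R r → R k
  exists_fac : ∀ {a b : B} (f : a ⟶ b), S.obj a →
    ∃ (m : B) (l : a ⟶ m) (r : m ⟶ b), S.obj m ∧ S.map l ∧ R r ∧ Nonempty (l ≫ r ≅ f)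

namespace IsLeftPart

theorem isGeneric (h : S.IsLeftPart R) (hr : R r) :
    IsGeneric (opPseudofunctor S.inclusion) (a := op A) r.op :=
  isGeneric_of_existsUnique_cell
    (fun u v _ α => OpDiagonal.nonempty_of_biOrth (h.biOrth u.unop.mem hr) α.unop2
      fun _ l => h.map_of_comp l u.unop.mem v.unop.mem)
    (fun u _ _ _ α α' φ hφ => OpDiagonal.existsUnique_compatible (β := α.unop2) (β' := α'.unop2)
      (h.biOrth u.unop.mem hr) φ.unop2 (congrArg Hom2.unop2 hφ))

theorem right_of_isGeneric (h : S.IsLeftPart R)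
    (hr : IsGeneric (opPseudofunctor S.inclusion) (a := op A) r.op) : R r := by
  obtain ⟨m, l, r', hm, hl, hr', ⟨θ⟩⟩ := h.exists_fac r A.mem
  have hg := h.isGeneric (A := ⟨m, hm⟩) hr'
  obtain ⟨⟨w, ν, ω, fac⟩, -⟩ := hg.exists_diagonal (a₁ := op A) (a₂ := op A) (𝟙 A : A ⟶ A).op
    (Quiver.Hom.op ⟨l, hl⟩) r.op (λ_ r ≪≫ θ.symm).op2
  obtain ⟨e, rfl⟩ := hg.exists_equivalence hr ⟨w, ν, ω, fac⟩
  exact h.right_of_equivalence_comp (mapEquivalence S.inclusion (unopEquivalence e)) ν.unop2.symm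
    hr'

theorem isGeneric_iff (h : S.IsLeftPart R) (A : S.Obj) (b : B) (r : A.obj ⟶ b) :
    IsGeneric (opPseudofunctor S.inclusion) (a := op A) r.op ↔ R r :=
  ⟨h.right_of_isGeneric, h.isGeneric⟩

theorem isBistable (h : S.IsLeftPart R) : IsBistable (opPseudofunctor S.inclusion) :=
  isBistable_of_exists_fac fun {_ a} f => by
    obtain ⟨m, l, r, hm, hl, hr, ⟨θ⟩⟩ := h.exists_fac f.unop a.unop.mem
    exact ⟨op ⟨m, hm⟩, r.op, Quiver.Hom.op ⟨l, hl⟩, h.isGeneric (A := ⟨m, hm⟩) hr, ⟨θ.op2⟩⟩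

end IsLeftPart

end SubBicat

namespace PseudoSlice

variable {C : Type u} [Bicategory.{w, v} C] {c : C}

/-- The domain pseudofunctor of the pseudoslice over `c`. -/
def forget (c : C) : PseudoSlice c ⥤ᵖ C where
  obj X := X.left
  map f := f.left
  map₂ φ := φ.left
  map₂_id _ := rfl
  map₂_comp _ _ := rfl
  mapId _ := Iso.refl _
  mapComp _ _ := Iso.refl _
  map₂_whisker_left f _ _ φ := by
    change f.left ◁ φ.left = 𝟙 _ ≫ f.left ◁ φ.left ≫ 𝟙 _
    simp
  map₂_whisker_right φ h := by
    change φ.left ▷ h.left = 𝟙 _ ≫ φ.left ▷ h.left ≫ 𝟙 _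
    simp
  map₂_associator f g h := by
    change (α_ f.left g.left h.left).hom = 𝟙 _ ≫ 𝟙 (f.left ≫ g.left) ▷ h.left ≫
      (α_ _ _ _).hom ≫ f.left ◁ 𝟙 (g.left ≫ h.left) ≫ 𝟙 _
    simp
  map₂_left_unitor {X _} f := by
    change (λ_ f.left).hom = 𝟙 _ ≫ 𝟙 (𝟙 X.left) ▷ f.left ≫ (λ_ f.left).hom
    simp
  map₂_right_unitor {_ Y} f := by
    change (ρ_ f.left).hom = 𝟙 _ ≫ f.left ◁ 𝟙 (𝟙 Y.left) ≫ (ρ_ f.left).hom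
    simp

variable {X Y Z W : PseudoSlice c} {f : X ⟶ Y} {g : Z ⟶ W}

theorem whiskerRight_comp_iso_hom_of_whiskerRight {s t : Y ⟶ Z} {σ : s.left ⟶ t.left}
    (h : σ ▷ g.left ▷ W.hom ≫ (t ≫ g).iso.hom = (s ≫ g).iso.hom) :
    σ ▷ Z.hom ≫ t.iso.hom = s.iso.hom := by
  rw [← cancel_epi (s.left ◁ g.iso.hom), ← cancel_epi (α_ s.left g.left W.hom).hom]
  simpa [whisker_exchange_assoc] using h

theorem exists_iso_of_filler {u : X ⟶ Z} {v : Y ⟶ W} (α : u ≫ g ≅ f ≫ v) {s : Y.left ⟶ Z.left}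
    (l : f.left ≫ s ≅ u.left) (r : s ≫ g.left ≅ v.left)
    (w : l.hom ▷ g.left ≫ α.hom.left = (α_ _ _ _).hom ≫ f.left ◁ r.hom) :
    ∃ i : s ≫ Z.hom ≅ Y.hom,
      l.hom ▷ Z.hom ≫ u.iso.hom = (α_ _ _ _).hom ≫ f.left ◁ i.hom ≫ f.iso.hom ∧
      r.hom ▷ W.hom ≫ v.iso.hom = (α_ _ _ _).hom ≫ s ◁ g.iso.hom ≫ i.hom := by
  refine ⟨whiskerLeftIso s g.iso.symm ≪≫ (α_ _ _ _).symm ≪≫ whiskerRightIso r W.hom ≪≫ v.iso,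
    ?_, by simp⟩
  have hα : α.hom.left ▷ W.hom ≫ (α_ _ _ _).hom ≫ f.left ◁ v.iso.hom ≫ f.iso.hom =
      (α_ _ _ _).hom ≫ u.left ◁ g.iso.hom ≫ u.iso.hom := by
    simpa using α.hom.w
  have hr : f.left ◁ (r.hom ▷ W.hom) = (α_ _ _ _).inv ≫
      ((α_ _ _ _).inv ≫ l.hom ▷ g.left ≫ α.hom.left) ▷ W.hom ≫ (α_ _ _ _).hom := by
    simp [w]
  have hl : l.hom ▷ Z.hom = (f.left ≫ s) ◁ g.iso.inv ≫ l.hom ▷ (g.left ≫ W.hom) ≫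
      u.left ◁ g.iso.hom := by
    rw [← whisker_exchange]
    simp
  simp [hl, reassoc_of% hr, hα]

theorem biOrth_of_left (h : BiOrth f.left g.left) : BiOrth f g := by
  refine (biOrth_iff f g).2 ⟨fun s t φ ψ w => ?_, fun u v α => ?_⟩
  · obtain ⟨σ, ⟨hφ, hψ⟩, unique⟩ :=
      h.existsUnique_cell φ.left ψ.left (congrArg Hom₂.left w)
    have hσ : σ ▷ Z.hom ≫ t.iso.hom = s.iso.hom :=
      whiskerRight_comp_iso_hom_of_whiskerRight (hψ ▸ ψ.w)
    exact ⟨⟨σ, hσ⟩, ⟨hom₂_ext hφ, hom₂_ext hψ⟩, fun τ hτ =>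
      hom₂_ext (unique τ.left ⟨congrArg Hom₂.left hτ.1, congrArg Hom₂.left hτ.2⟩)⟩
  · obtain ⟨s, l, r, w⟩ := h.exists_filler ((forget c).map₂Iso α)
    obtain ⟨i, hl, hr⟩ := exists_iso_of_filler α l r w
    exact ⟨⟨s, i⟩, isoMk l (by simpa using hl), isoMk r (by simpa using hr), hom₂_ext w⟩

end PseudoSlice

section LeftObjects

variable {C : Type u} [Bicategory.{w, v} C] {L R : MorphismProperty C}

theorem isLeftPart_leftObj (h : IsBifactorizationSystem L R) {t : C} (ht : IsBiterminal t) :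
    (leftObj h t).IsLeftPart R where
  biOrth := h.biOrth
  map_of_comp := h.left_of_comp
  right_of_equivalence_comp := h.right_of_equivalence_comp
  exists_fac := by
    rintro a b f ⟨p, hp⟩
    obtain ⟨m, l, r, θ, hl, hr, -⟩ := h.exists_fac f
    obtain ⟨q⟩ := ht.nonempty_hom m
    obtain ⟨i⟩ := ht.nonempty_iso (l ≫ q) p
    exact ⟨m, l, r, ⟨q, h.left_of_comp i hl hp⟩, hl, hr, ⟨θ⟩⟩

theorem isLeftPart_leftObjOver (h : IsBifactorizationSystem L R) (c : C) :
    (leftObjOver h c).IsLeftPart (fun _ _ r => R r.left) where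
  biOrth hf hg := PseudoSlice.biOrth_of_left (h.biOrth hf hg)
  map_of_comp i := h.left_of_comp ((PseudoSlice.forget c).map₂Iso i)
  right_of_equivalence_comp e _ _ i := h.right_of_equivalence_comp
    (mapEquivalence (PseudoSlice.forget c) e) ((PseudoSlice.forget c).map₂Iso i)
  exists_fac := by
    intro a b f ha
    obtain ⟨m, l, r, θ, hl, hr, -⟩ := h.exists_fac f.left
    let i : l ≫ r ≫ b.hom ≅ a.hom := (α_ _ _ _).symm ≪≫ whiskerRightIso θ b.hom ≪≫ f.iso
    exact ⟨⟨m, r ≫ b.hom⟩, ⟨l, i⟩, ⟨r, Iso.refl _⟩, h.left_of_comp i hl ha, hl, hr,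
      ⟨PseudoSlice.isoMk θ (by simp [i])⟩⟩

end LeftObjects

end BistableInclusion

theorem mainTheorem3 {C : Type u} [Bicategory.{w, v} C] (L R : MorphismProperty C)
    (h : IsBifactorizationSystem L R) (t : C) (ht : IsBiterminal t) :
    (IsBistable (opPseudofunctor (leftObj h t).inclusion) ∧
      ∀ (A : (leftObj h t).Obj) (B : C) (r : A.obj ⟶ B),
        IsGeneric (opPseudofunctor (leftObj h t).inclusion) (a := op A) r.op ↔ R r) ∧
    ∀ c : C, IsBistable (opPseudofunctor (leftObjOver h c).inclusion) ∧
      ∀ (A : (leftObjOver h c).Obj) (B : PseudoSlice c) (r : A.obj ⟶ B),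
        IsGeneric (opPseudofunctor (leftObjOver h c).inclusion) (a := op A) r.op ↔ R r.left :=
  ⟨⟨(isLeftPart_leftObj h ht).isBistable, (isLeftPart_leftObj h ht).isGeneric_iff⟩, fun c =>
    ⟨(isLeftPart_leftObjOver h c).isBistable, (isLeftPart_leftObjOver h c).isGeneric_iff⟩⟩
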